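/- A commutative $\dagger$-Frobenius monoid in $\mathbf{FdHilb}$ (finite-dimensional complex Hilbert spaces and linear maps, with the usual tensor product and the adjoint $\dagger$) is a triple $(H,m,u)$, with $m:H\otimes H\to H$ and $u:\mathbb{C}\to H$ linear, such that, for $\delta=m^\dagger$ and $\epsilon=u^\dagger$: $(H,m,u)$ is a monoid, $(H,\delta,\epsilon)$ is a comonoid, the Frobenius condition $(m\otimes \mathrm{id}_H)\circ(\mathrm{id}_H\otimes\delta)=\delta\circ m=(\mathrm{id}_H\otimes m)\circ(\delta\otimes \mathrm{id}_H)$ holds, and $\sigma\circ\delta=\delta$, where $\sigma$ is the swap on $H\otimes H$. Let $\mathbf{C}$ be the category whose objects are the commutative $\dagger$-Frobenius monoids in $\mathbf{FdHilb}$ and whose morphisms $(H,m,u)\to(H',m',u')$ are the linear maps $f:H\to H'$ that preserve multiplication, unit, comultiplication and counit: $$f\circ m=m'\circ(f\otimes f),\quad f\circ u=u',\quad \delta'\circ f=(f\otimes f)\circ\delta,\quad \epsilon'\circ f=\epsilon .$$ Let $\mathbf{G}$ be the groupoid whose objects are the finite sets $X$ equipped with a function $w_X:X\to\mathbb{R}_{>0}$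 and whose morphisms $X\to Y$ are the bijections $\beta:X\to Y$ with $w_Y\circ\beta=w_X$. Then the categories $\mathbf{C}$ and $\mathbf{G}$ are equivalent. -/

import Mathlib

open CategoryTheory TensorProduct

universe u

section Frobenius

variable {H : Type u} [NormedAddCommGroup H] [InnerProductSpace ℂ H]

/-- `(H, m, u)` is an internal monoid in complex vector spaces. -/
structure IsInternalMonoid (m : H ⊗[ℂ] H →ₗ[ℂ] H) (u : ℂ →ₗ[ℂ] H) : Prop where
  assoc : m ∘ₗ m.rTensor H = m ∘ₗ m.lTensor H ∘ₗ (TensorProduct.assoc ℂ H H H).toLinearMap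
  unit_mul : m ∘ₗ u.rTensor H = (TensorProduct.lid ℂ H).toLinearMap
  mul_unit : m ∘ₗ u.lTensor H = (TensorProduct.rid ℂ H).toLinearMap

/-- `(H, δ, ε)` is an internal comonoid in complex vector spaces. -/
structure IsInternalComonoid (δ : H →ₗ[ℂ] H ⊗[ℂ] H) (ε : H →ₗ[ℂ] ℂ) : Prop where
  coassoc : (TensorProduct.assoc ℂ H H H).toLinearMap ∘ₗ δ.rTensor H ∘ₗ δ = δ.lTensor H ∘ₗ δ
  counit_comul : ε.rTensor H ∘ₗ δ = (TensorProduct.lid ℂ H).symm.toLinearMap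
  comul_counit : ε.lTensor H ∘ₗ δ = (TensorProduct.rid ℂ H).symm.toLinearMap

/-- `(H, m, u, δ, ε)` is a Frobenius monoid: a monoid and a comonoid for which
`(m ⊗ 1) ∘ (1 ⊗ δ) = δ ∘ m = (1 ⊗ m) ∘ (δ ⊗ 1)`, the associators being written out. -/
structure IsFrobeniusMonoid (m : H ⊗[ℂ] H →ₗ[ℂ] H) (u : ℂ →ₗ[ℂ] H)
    (δ : H →ₗ[ℂ] H ⊗[ℂ] H) (ε : H →ₗ[ℂ] ℂ) : Prop where
  monoid : IsInternalMonoid m u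
  comonoid : IsInternalComonoid δ ε
  frobenius_left :
    m.rTensor H ∘ₗ (TensorProduct.assoc ℂ H H H).symm.toLinearMap ∘ₗ δ.lTensor H = δ ∘ₗ m
  frobenius_right :
    m.lTensor H ∘ₗ (TensorProduct.assoc ℂ H H H).toLinearMap ∘ₗ δ.rTensor H = δ ∘ₗ m

/-- A Frobenius monoid is commutative if `σ ∘ δ = δ`, where `σ` is the swap. -/
structure IsCommFrobeniusMonoid (m : H ⊗[ℂ] H →ₗ[ℂ] H) (u : ℂ →ₗ[ℂ] H)
    (δ : H →ₗ[ℂ] H ⊗[ℂ] H) (ε : H →ₗ[ℂ] ℂ) : Prop extends IsFrobeniusMonoid m u δ ε where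
  comm : (TensorProduct.comm ℂ H H).toLinearMap ∘ₗ δ = δ

/-- `(H, m, u)` is a commutative `†`-Frobenius monoid if `(H, m, u, m†, u†)` is a commutative
Frobenius monoid; `†` is the Hilbert space adjoint, with respect to the usual inner product
`⟪a ⊗ b, c ⊗ d⟫ = ⟪a, c⟫ * ⟪b, d⟫` on `H ⊗ H`. -/
def IsCommDaggerFrobeniusMonoid [FiniteDimensional ℂ H]
    (m : H ⊗[ℂ] H →ₗ[ℂ] H) (u : ℂ →ₗ[ℂ] H) : Prop :=
  IsCommFrobeniusMonoid m u (LinearMap.adjoint m) (LinearMap.adjoint u)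

end Frobenius

/-- A commutative `†`-Frobenius monoid in `FdHilb`, the category of finite-dimensional complex
Hilbert spaces and linear maps. -/
structure CommDaggerFrob : Type (u + 1) where
  carrier : Type u
  [normedAddCommGroup : NormedAddCommGroup carrier]
  [innerProductSpace : InnerProductSpace ℂ carrier]
  [finiteDimensional : FiniteDimensional ℂ carrier]
  mul : carrier ⊗[ℂ] carrier →ₗ[ℂ] carrier
  unit : ℂ →ₗ[ℂ] carrier
  isCommDaggerFrobeniusMonoid : IsCommDaggerFrobeniusMonoid mul unit

namespace CommDaggerFrob

attribute [instance] normedAddCommGroup innerProductSpace finiteDimensional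

/-- The comultiplication `m†`. -/
noncomputable def comul (A : CommDaggerFrob.{u}) :
    A.carrier →ₗ[ℂ] A.carrier ⊗[ℂ] A.carrier :=
  LinearMap.adjoint A.mul

/-- The counit `u†`. -/
noncomputable def counit (A : CommDaggerFrob.{u}) : A.carrier →ₗ[ℂ] ℂ :=
  LinearMap.adjoint A.unit

/-- A linear map which preserves multiplication, unit, comultiplication and counit. -/
@[ext]
structure Hom (A B : CommDaggerFrob.{u}) : Type u where
  toLinearMap : A.carrier →ₗ[ℂ] B.carrier
  map_mul : toLinearMap ∘ₗ A.mul = B.mul ∘ₗ TensorProduct.map toLinearMap toLinearMap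
  map_unit : toLinearMap ∘ₗ A.unit = B.unit
  map_comul : B.comul ∘ₗ toLinearMap = TensorProduct.map toLinearMap toLinearMap ∘ₗ A.comul
  map_counit : B.counit ∘ₗ toLinearMap = A.counit

noncomputable instance : Category.{u} CommDaggerFrob.{u} where
  Hom := Hom
  id A :=
    { toLinearMap := LinearMap.id
      map_mul := by simp
      map_unit := by simp
      map_comul := by simp
      map_counit := by simp }
  comp f g :=
    { toLinearMap := g.toLinearMap ∘ₗ f.toLinearMap
      map_mul := by
        rw [LinearMap.comp_assoc, f.map_mul, ← LinearMap.comp_assoc, g.map_mul,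
          LinearMap.comp_assoc, ← TensorProduct.map_comp]
      map_unit := by rw [LinearMap.comp_assoc, f.map_unit, g.map_unit]
      map_comul := by
        rw [← LinearMap.comp_assoc, g.map_comul, LinearMap.comp_assoc, f.map_comul,
          ← LinearMap.comp_assoc, ← TensorProduct.map_comp]
      map_counit := by rw [← LinearMap.comp_assoc, g.map_counit, f.map_counit] }

end CommDaggerFrob

/-- A finite set equipped with a function into the positive real numbers. -/
structure FinPosSet : Type (u + 1) where
  carrier : Type u
  [finite : Finite carrier]
  weight : carrier → {r : ℝ // 0 < r}

namespace FinPosSet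

/-- A bijection that preserves the functions into the positive real numbers. -/
@[ext]
structure Hom (X Y : FinPosSet.{u}) : Type u where
  toEquiv : X.carrier ≃ Y.carrier
  weight_map : ∀ x, Y.weight (toEquiv x) = X.weight x

instance : Groupoid.{u} FinPosSet.{u} where
  Hom := Hom
  id X := { toEquiv := Equiv.refl _, weight_map := fun _ => rfl }
  comp f g :=
    { toEquiv := f.toEquiv.trans g.toEquiv
      weight_map := fun x => (g.weight_map _).trans (f.weight_map x) }
  inv {_ Y} f :=
    { toEquiv := f.toEquiv.symm
      weight_map := fun y =>
        (f.weight_map _).symm.trans (congrArg Y.weight (f.toEquiv.apply_symm_apply y)) }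
  inv_comp f := Hom.ext (Equiv.symm_trans_self f.toEquiv)
  comp_inv f := Hom.ext (Equiv.self_trans_symm f.toEquiv)

end FinPosSet

/-!
The equivalence sends a commutative `†`-Frobenius monoid `A` to the set of its copyable points,
the vectors `x` with `δ x = x ⊗ x` and `ε x = 1`, weighted by `‖x‖ ^ 2`. Everything rests on the
fact that the copyable points form an orthogonal basis of `A`.

* The Frobenius and counit laws give `x * a = ⟪x, a⟫ • x` for a copyable point `x`
  (`IsCopyable.mul_eq`). As the multiplication is commutative, distinct copyable points are
  orthogonal (`IsCopyable.inner_eq_zero`), hence linearly independent.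
* The Frobenius law makes the adjoint of a multiplication operator a multiplication operator
  (`exists_inner_mul_eq`), so every multiplication operator is a combination of two symmetric ones.
  The symmetric ones commute, so `A` is spanned by their joint eigenvectors, which are then
  eigenvectors of all multiplication operators. For such an eigenvector `v`, the Frobenius law shows
  that `δ v` has the form `v ⊗ w`, and the counit law that `v` is a multiple of a copyable point
  (`IsCopyable.mem_span_of_forall_mul_mem`). So the copyable points span (`span_copyable`).

Morphisms preserve copyable points, and they preserve inner products of copyable points since
`⟪x, y⟫ = ε (x * y)`. So they induce weight-preserving injections on copyable points; these are
surjective because a copyable point outside the image would be annihilated by the image of the unit,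
that is, by the unit. The resulting functor is faithful because copyable points span, full
because a bijection of bases extends linearly, and essentially surjective because any weights are the
squared norms of an orthogonal basis, which is copied by a `†`-Frobenius structure
(`isCommDaggerFrobeniusMonoid_of_basis`).
-/

/-! ### Elementwise form of the axioms -/

namespace CommDaggerFrob

open scoped InnerProductSpace

variable {A B : CommDaggerFrob.{u}}

theorem inner_comul (a : A.carrier) (t : A.carrier ⊗[ℂ] A.carrier) :
    ⟪A.comul a, t⟫_ℂ = ⟪a, A.mul t⟫_ℂ :=
  LinearMap.adjoint_inner_left _ _ _

theorem mul_assoc (a b c : A.carrier) :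
    A.mul (A.mul (a ⊗ₜ b) ⊗ₜ c) = A.mul (a ⊗ₜ A.mul (b ⊗ₜ c)) := by
  simpa using LinearMap.congr_fun A.isCommDaggerFrobeniusMonoid.monoid.assoc ((a ⊗ₜ b) ⊗ₜ c)

theorem one_mul (a : A.carrier) : A.mul (A.unit 1 ⊗ₜ a) = a := by
  simpa using LinearMap.congr_fun A.isCommDaggerFrobeniusMonoid.monoid.unit_mul (1 ⊗ₜ a)

theorem mul_one (a : A.carrier) : A.mul (a ⊗ₜ A.unit 1) = a := by
  simpa using LinearMap.congr_fun A.isCommDaggerFrobeniusMonoid.monoid.mul_unit (a ⊗ₜ 1)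

theorem counit_rTensor_comul (a : A.carrier) :
    A.counit.rTensor A.carrier (A.comul a) = 1 ⊗ₜ a :=
  LinearMap.congr_fun A.isCommDaggerFrobeniusMonoid.comonoid.counit_comul a

theorem counit_lTensor_comul (a : A.carrier) :
    A.counit.lTensor A.carrier (A.comul a) = a ⊗ₜ 1 :=
  LinearMap.congr_fun A.isCommDaggerFrobeniusMonoid.comonoid.comul_counit a

theorem comul_mul_left (a b : A.carrier) :
    A.comul (A.mul (a ⊗ₜ b)) = A.mul.rTensor A.carrier
      ((TensorProduct.assoc ℂ A.carrier A.carrier A.carrier).symm (a ⊗ₜ A.comul b)) :=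
  (LinearMap.congr_fun A.isCommDaggerFrobeniusMonoid.frobenius_left (a ⊗ₜ b)).symm

theorem comul_mul_right (a b : A.carrier) :
    A.comul (A.mul (a ⊗ₜ b)) = A.mul.lTensor A.carrier
      (TensorProduct.assoc ℂ A.carrier A.carrier A.carrier (A.comul a ⊗ₜ b)) :=
  (LinearMap.congr_fun A.isCommDaggerFrobeniusMonoid.frobenius_right (a ⊗ₜ b)).symm

/-- The multiplication is commutative, as the adjoint of a cocommutative comultiplication. -/
theorem mul_comm (a b : A.carrier) : A.mul (a ⊗ₜ b) = A.mul (b ⊗ₜ a) := by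
  refine ext_inner_left ℂ fun c => ?_
  have h : TensorProduct.comm ℂ A.carrier A.carrier (A.comul c) = A.comul c :=
    LinearMap.congr_fun A.isCommDaggerFrobeniusMonoid.comm c
  rw [← inner_comul, ← inner_comul]
  nth_rw 1 [← h]
  exact (TensorProduct.commIsometry ℂ A.carrier A.carrier).inner_map_map _ (b ⊗ₜ a)

/-! ### Copyable points -/

/-- A copyable point: a vector which is copied by the comultiplication and deleted by the counit.
Given the first condition, the second one only excludes the zero vector. -/
structure IsCopyable (x : A.carrier) : Prop where
  comul_eq : A.comul x = x ⊗ₜ x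
  counit_eq : A.counit x = 1

namespace IsCopyable

variable {x y : A.carrier}

theorem ne_zero (hx : IsCopyable x) : x ≠ 0 := by
  rintro rfl
  simpa using hx.counit_eq

/-- By the Frobenius law, `δ (x * a) = x ⊗ (x * a)`; the counit law for the second factor gives the
claim. -/
theorem mul_eq_counit_smul (hx : IsCopyable x) (a : A.carrier) :
    A.mul (x ⊗ₜ a) = A.counit (A.mul (x ⊗ₜ a)) • x := by
  have h := counit_lTensor_comul (A.mul (x ⊗ₜ a))
  rw [comul_mul_right, hx.comul_eq] at h
  simpa using (congrArg (TensorProduct.rid ℂ A.carrier) h).symm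

theorem counit_mul (hx : IsCopyable x) (a : A.carrier) :
    A.counit (A.mul (x ⊗ₜ a)) = ⟪x, a⟫_ℂ := by
  have h : ⟪x, A.mul (x ⊗ₜ a)⟫_ℂ = ⟪x, x⟫_ℂ * ⟪x, a⟫_ℂ := by
    rw [← inner_comul, hx.comul_eq, TensorProduct.inner_tmul]
  rw [hx.mul_eq_counit_smul, inner_smul_right, _root_.mul_comm] at h
  exact mul_left_cancel₀ (inner_self_ne_zero.mpr hx.ne_zero) h

/-- Multiplication by a copyable point is an unnormalised projection onto its span. -/
theorem mul_eq (hx : IsCopyable x) (a : A.carrier) : A.mul (x ⊗ₜ a) = ⟪x, a⟫_ℂ • x := by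
  rw [← hx.counit_mul, ← hx.mul_eq_counit_smul]

theorem inner_eq_zero (hx : IsCopyable x) (hy : IsCopyable y) (hxy : x ≠ y) :
    ⟪x, y⟫_ℂ = 0 := by
  have h := mul_comm x y
  rw [hx.mul_eq, hy.mul_eq, ← hy.counit_mul, ← mul_comm, hx.counit_mul] at h
  by_contra h0
  exact hxy (smul_right_injective _ h0 h)

/-- A simultaneous eigenvector of all multiplication operators is a multiple of a copyable point:
its comultiplication is `v ⊗ w` for some `w`, and `v = ε v • w` by the counit law. -/
theorem mem_span_of_forall_mul_mem {v : A.carrier}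
    (hv : ∀ a, ∃ c : ℂ, A.mul (v ⊗ₜ a) = c • v) :
    v ∈ Submodule.span ℂ {x : A.carrier | IsCopyable x} := by
  have key : ∀ t : A.carrier ⊗[ℂ] A.carrier, ∃ w, A.mul.rTensor A.carrier
      ((TensorProduct.assoc ℂ A.carrier A.carrier A.carrier).symm (v ⊗ₜ t)) = v ⊗ₜ[ℂ] w := by
    intro t
    induction t with
    | zero => exact ⟨0, by simp⟩
    | tmul a b =>
      obtain ⟨c, hc⟩ := hv a
      exact ⟨c • b, by simp [hc, TensorProduct.smul_tmul]⟩
    | add s t hs ht =>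
      obtain ⟨w, hw⟩ := hs
      obtain ⟨w', hw'⟩ := ht
      exact ⟨w + w', by simp [TensorProduct.tmul_add, hw, hw']⟩
  obtain ⟨w, hw⟩ := key (A.comul (A.unit 1))
  rw [← comul_mul_left, mul_one] at hw
  have h := counit_rTensor_comul v
  rw [hw] at h
  have hvw : A.counit v • w = v := by
    simpa using congrArg (TensorProduct.lid ℂ A.carrier) h
  by_cases h0 : A.counit v = 0
  · rw [← hvw, h0, zero_smul]
    exact zero_mem _
  · have hwc : IsCopyable w := by
      have hw1 : w = (A.counit v)⁻¹ • v := by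
        rw [← hvw, smul_smul, hvw, inv_mul_cancel₀ h0, one_smul]
      constructor
      · conv_lhs => rw [hw1, map_smul, hw, TensorProduct.smul_tmul', ← hw1]
      · rw [hw1, map_smul, smul_eq_mul, inv_mul_cancel₀ h0]
    rw [← hvw]
    exact Submodule.smul_mem _ _ (Submodule.subset_span hwc)

end IsCopyable

/-! ### The copyable points form an orthogonal basis -/

/-- Multiplication by `a` has an adjoint of the same form. -/
theorem exists_inner_mul_eq (a : A.carrier) : ∃ a' : A.carrier, ∀ b c : A.carrier,
    ⟪A.mul (a' ⊗ₜ b), c⟫_ℂ = ⟪b, A.mul (a ⊗ₜ c)⟫_ℂ := by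
  have key : ∀ t : A.carrier ⊗[ℂ] A.carrier, ∃ a' : A.carrier, ∀ b c : A.carrier,
      ⟪A.mul (a' ⊗ₜ b), c⟫_ℂ = ⟪A.mul.lTensor A.carrier
        (TensorProduct.assoc ℂ A.carrier A.carrier A.carrier (t ⊗ₜ b)), a ⊗ₜ[ℂ] c⟫_ℂ := by
    intro t
    -- On pure tensors, `a'` is `p ⊗ q` contracted with `a`.
    induction t with
    | zero => exact ⟨0, by simp⟩
    | tmul p q =>
      refine ⟨⟪a, p⟫_ℂ • q, fun b c => ?_⟩
      rw [← TensorProduct.smul_tmul', map_smul, inner_smul_left, inner_conj_symm]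
      simp
    | add s t hs ht =>
      obtain ⟨p, hp⟩ := hs
      obtain ⟨q, hq⟩ := ht
      exact ⟨p + q, fun b c => by simp [TensorProduct.add_tmul, inner_add_left, hp, hq]⟩
  obtain ⟨a', h⟩ := key (A.comul (A.unit 1))
  refine ⟨a', fun b c => ?_⟩
  rw [h, ← comul_mul_right, one_mul, inner_comul]

/-- Multiplication by `a`, as a linear operator. -/
noncomputable def mulLeft (a : A.carrier) : A.carrier →ₗ[ℂ] A.carrier :=
  A.mul ∘ₗ TensorProduct.mk ℂ A.carrier A.carrier a

theorem mulLeft_apply (a b : A.carrier) : mulLeft a b = A.mul (a ⊗ₜ b) := rfl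

theorem mulLeft_commute (a b : A.carrier) : Commute (mulLeft a) (mulLeft b) := by
  ext c
  simp only [Module.End.mul_apply, mulLeft_apply]
  rw [← mul_assoc, mul_comm a b, mul_assoc]

/-- The decomposition into real and imaginary parts, with respect to the adjoint of
`exists_inner_mul_eq`. -/
theorem exists_symmetric_decomposition (a : A.carrier) : ∃ s t : A.carrier,
    (mulLeft s).IsSymmetric ∧ (mulLeft t).IsSymmetric ∧ a = s + Complex.I • t := by
  obtain ⟨a', ha⟩ := exists_inner_mul_eq a
  have ha' (b c : A.carrier) : ⟪A.mul (a ⊗ₜ b), c⟫_ℂ = ⟪b, A.mul (a' ⊗ₜ c)⟫_ℂ := by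
    rw [← inner_conj_symm, ← ha, inner_conj_symm]
  refine ⟨(2⁻¹ : ℂ) • (a + a'), (-Complex.I * 2⁻¹) • (a - a'), fun b c => ?_, fun b c => ?_, ?_⟩
  · simp only [mulLeft_apply, ← TensorProduct.smul_tmul', map_smul, TensorProduct.add_tmul, map_add,
      inner_smul_left, inner_smul_right, inner_add_left, inner_add_right, ha, ha', map_inv₀,
      map_ofNat]
    ring
  · simp only [mulLeft_apply, ← TensorProduct.smul_tmul', map_smul, TensorProduct.sub_tmul, map_sub,
      inner_smul_left, inner_smul_right, inner_sub_left, inner_sub_right, ha, ha', map_inv₀,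
      map_ofNat, map_mul, map_neg, Complex.conj_I]
    ring
  · rw [smul_smul, ← _root_.mul_assoc, mul_neg, Complex.I_mul_I]
    module

theorem span_copyable : Submodule.span ℂ {x : A.carrier | IsCopyable x} = ⊤ := by
  have h := LinearMap.IsSymmetric.iSup_iInf_eq_top_of_commute
    (T := fun s : {s : A.carrier // (mulLeft s).IsSymmetric} => mulLeft s.1)
    (fun s => s.2) (fun s t _ => mulLeft_commute s.1 t.1)
  rw [eq_top_iff, ← h]
  refine iSup_le fun χ v hv => IsCopyable.mem_span_of_forall_mul_mem fun a => ?_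
  obtain ⟨s, t, hs, ht, rfl⟩ := exists_symmetric_decomposition a
  rw [Submodule.mem_iInf] at hv
  have h1 : A.mul (s ⊗ₜ v) = χ ⟨s, hs⟩ • v := Module.End.mem_eigenspace_iff.mp (hv ⟨s, hs⟩)
  have h2 : A.mul (t ⊗ₜ v) = χ ⟨t, ht⟩ • v := Module.End.mem_eigenspace_iff.mp (hv ⟨t, ht⟩)
  refine ⟨χ ⟨s, hs⟩ + Complex.I * χ ⟨t, ht⟩, ?_⟩
  rw [mul_comm, TensorProduct.add_tmul, ← TensorProduct.smul_tmul', map_add, map_smul, h1, h2,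
    add_smul, mul_smul]

variable (A) in
/-- The copyable points of `A`. -/
abbrev Point : Type u := {x : A.carrier // IsCopyable x}

theorem inner_point (x y : Point A) [Decidable (x = y)] :
    ⟪x.1, y.1⟫_ℂ = if x = y then ((‖x.1‖ ^ 2 : ℝ) : ℂ) else 0 := by
  split_ifs with h
  · rw [← h, inner_self_eq_norm_sq_to_K]
    norm_cast
  · exact x.2.inner_eq_zero y.2 fun h' => h (Subtype.ext h')

variable (A) in
theorem linearIndependent_point : LinearIndependent ℂ (Subtype.val : Point A → A.carrier) :=
  linearIndependent_of_ne_zero_of_inner_eq_zero (fun x => x.2.ne_zero)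
    fun x y hxy => x.2.inner_eq_zero y.2 fun h => hxy (Subtype.ext h)

instance finite_point : Finite (Point A) := (linearIndependent_point A).finite

variable (A) in
/-- The basis of copyable points. -/
noncomputable def pointBasis : Module.Basis (Point A) ℂ A.carrier :=
  Module.Basis.mk (linearIndependent_point A) (by
    rw [Subtype.range_coe_subtype, span_copyable])

@[simp]
theorem pointBasis_apply (x : Point A) : pointBasis A x = x.1 :=
  Module.Basis.mk_apply _ _ _

/-! ### Morphisms act on copyable points -/

namespace Hom

variable (f : Hom A B)

theorem map_mul_apply (a b : A.carrier) : f.toLinearMap (A.mul (a ⊗ₜ b)) =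
    B.mul (f.toLinearMap a ⊗ₜ f.toLinearMap b) := by
  simpa using LinearMap.congr_fun f.map_mul (a ⊗ₜ b)

theorem counit_apply (a : A.carrier) : B.counit (f.toLinearMap a) = A.counit a :=
  LinearMap.congr_fun f.map_counit a

theorem isCopyable {x : A.carrier} (hx : IsCopyable x) : IsCopyable (f.toLinearMap x) where
  comul_eq := by simpa [hx.comul_eq] using LinearMap.congr_fun f.map_comul x
  counit_eq := (f.counit_apply x).trans hx.counit_eq

theorem inner_map_map {x y : A.carrier} (hx : IsCopyable x) :
    ⟪f.toLinearMap x, f.toLinearMap y⟫_ℂ = ⟪x, y⟫_ℂ := by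
  rw [← (f.isCopyable hx).counit_mul, ← map_mul_apply, counit_apply, hx.counit_mul]

/-- The map induced on copyable points. -/
def mapPoint (x : Point A) : Point B := ⟨f.toLinearMap x.1, f.isCopyable x.2⟩

theorem mapPoint_injective : Function.Injective f.mapPoint := by
  intro x y h
  by_contra hxy
  have h' : f.toLinearMap x.1 = f.toLinearMap y.1 := congrArg Subtype.val h
  have h0 := f.inner_map_map (y := y.1) x.2
  rw [x.2.inner_eq_zero y.2 fun e => hxy (Subtype.ext e), ← h', inner_self_eq_zero] at h0
  exact (f.isCopyable x.2).ne_zero h0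

theorem mapPoint_surjective : Function.Surjective f.mapPoint := by
  intro y
  by_contra! hy
  have h : mulLeft y.1 ∘ₗ f.toLinearMap = 0 := (pointBasis A).ext fun x => by
    have h0 := y.2.inner_eq_zero (f.isCopyable x.2) fun e => hy x (Subtype.ext e.symm)
    simp [mulLeft_apply, y.2.mul_eq, h0]
  apply y.2.ne_zero
  rw [← mul_one y.1, ← f.map_unit]
  exact LinearMap.congr_fun h (A.unit 1)

/-- The weight-preserving bijection induced on copyable points. -/
noncomputable def pointEquiv : Point A ≃ Point B :=
  Equiv.ofBijective f.mapPoint ⟨f.mapPoint_injective, f.mapPoint_surjective⟩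

theorem norm_pointEquiv (x : Point A) : ‖(f.pointEquiv x).1‖ = ‖x.1‖ := by
  have h : ⟪(f.pointEquiv x).1, (f.pointEquiv x).1⟫_ℂ = ⟪x.1, x.1⟫_ℂ := f.inner_map_map x.2
  rw [norm_eq_sqrt_re_inner (𝕜 := ℂ), h, ← norm_eq_sqrt_re_inner]

end Hom

/-- The linear extension of a norm-preserving bijection of copyable points is a morphism. -/
noncomputable def homOfEquiv (β : Point A ≃ Point B) (hβ : ∀ x, ‖(β x).1‖ = ‖x.1‖) : Hom A B :=
  let f : A.carrier →ₗ[ℂ] B.carrier := (pointBasis A).constr ℂ fun x => (β x).1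
  have hf (x : Point A) : f x.1 = (β x).1 := by
    rw [← pointBasis_apply x, Module.Basis.constr_basis]
  have hmul : f ∘ₗ A.mul = B.mul ∘ₗ TensorProduct.map f f := by
    classical
    refine ((pointBasis A).tensorProduct (pointBasis A)).ext fun ⟨x, y⟩ => ?_
    simp only [Module.Basis.tensorProduct_apply, pointBasis_apply, LinearMap.comp_apply,
      TensorProduct.map_tmul, hf, x.2.mul_eq, (β x).2.mul_eq, map_smul, inner_point, hβ,
      EmbeddingLike.apply_eq_iff_eq]
  { toLinearMap := f
    map_mul := hmul
    map_unit := by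
      -- `f 1` is a unit for the image of `f`, which is everything.
      have h1 : mulLeft (f (A.unit 1)) = LinearMap.id := (pointBasis B).ext fun y => by
        have h := LinearMap.congr_fun hmul (A.unit 1 ⊗ₜ (β.symm y).1)
        simp only [LinearMap.comp_apply, TensorProduct.map_tmul, one_mul, hf,
          Equiv.apply_symm_apply] at h
        simpa [mulLeft_apply] using h.symm
      ext
      have h := LinearMap.congr_fun h1 (B.unit 1)
      rwa [mulLeft_apply, mul_one] at h
    map_comul := (pointBasis A).ext fun x => by
      simp [hf, (β x).2.comul_eq, x.2.comul_eq]
    map_counit := (pointBasis A).ext fun x => by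
      simp [hf, (β x).2.counit_eq, x.2.counit_eq] }

theorem homOfEquiv_apply (β : Point A ≃ Point B) (hβ : ∀ x, ‖(β x).1‖ = ‖x.1‖) (x : Point A) :
    (homOfEquiv β hβ).toLinearMap x.1 = (β x).1 := by
  rw [← pointBasis_apply x]
  exact Module.Basis.constr_basis _ _ _ _

/-- The functor of copyable points, weighted by their squared norms. -/
noncomputable def points : CommDaggerFrob.{u} ⥤ FinPosSet.{u} where
  obj A :=
    { carrier := Point A
      weight := fun x => ⟨‖x.1‖ ^ 2, pow_pos (norm_pos_iff.mpr x.2.ne_zero) 2⟩ }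
  map f :=
    { toEquiv := Hom.pointEquiv f
      weight_map := fun x => Subtype.ext (by
        simpa only using congrArg (· ^ 2) (Hom.norm_pointEquiv f x)) }
  map_id _ := FinPosSet.Hom.ext (Equiv.ext fun _ => rfl)
  map_comp _ _ := FinPosSet.Hom.ext (Equiv.ext fun _ => rfl)

instance : points.{u}.Faithful where
  map_injective {A B} f g h := by
    refine Hom.ext ((pointBasis A).ext fun x => ?_)
    rw [pointBasis_apply]
    exact congrArg Subtype.val (Equiv.congr_fun (congrArg FinPosSet.Hom.toEquiv h) x)

instance : points.{u}.Full where
  map_surjective {A B} β := by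
    have hβ (x : Point A) : ‖(β.toEquiv x).1‖ = ‖x.1‖ :=
      (sq_eq_sq₀ (norm_nonneg _) (norm_nonneg _)).mp (congrArg Subtype.val (β.weight_map x))
    exact ⟨homOfEquiv β.toEquiv hβ, FinPosSet.Hom.ext (Equiv.ext fun x =>
      Subtype.ext (homOfEquiv_apply β.toEquiv hβ x))⟩

end CommDaggerFrob

/-! ### The Frobenius monoid of an orthogonal basis -/

section OrthogonalBasis

open scoped InnerProductSpace

variable {ι : Type*} {H : Type u} [NormedAddCommGroup H] [InnerProductSpace ℂ H]
  (b : Module.Basis ι ℂ H) (w : ι → ℝ)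

/-- The multiplication with `b i * b i = w i • b i` and `b i * b j = 0` for `i ≠ j`. -/
noncomputable def basisMul [DecidableEq ι] : H ⊗[ℂ] H →ₗ[ℂ] H :=
  TensorProduct.lift
    (b.constr ℂ fun i => b.constr ℂ fun j => if i = j then (w i : ℂ) • b i else 0)

theorem basisMul_tmul [DecidableEq ι] (i j : ι) :
    basisMul b w (b i ⊗ₜ b j) = if i = j then (w i : ℂ) • b i else 0 := by
  rw [basisMul, TensorProduct.lift.tmul, Module.Basis.constr_basis, Module.Basis.constr_basis]

/-- The unit of `basisMul`, provided that all `w i` are nonzero. -/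
noncomputable def basisUnit [Fintype ι] : ℂ →ₗ[ℂ] H :=
  LinearMap.toSpanSingleton ℂ H (∑ i, (w i : ℂ)⁻¹ • b i)

/-- The comultiplication that copies the basis `b`. -/
noncomputable def basisComul : H →ₗ[ℂ] H ⊗[ℂ] H := b.constr ℂ fun i => b i ⊗ₜ b i

/-- The counit that deletes the basis `b`. -/
noncomputable def basisCounit : H →ₗ[ℂ] ℂ := b.constr ℂ fun _ => (1 : ℂ)

@[simp]
theorem basisComul_apply (i : ι) : basisComul b (b i) = b i ⊗ₜ b i :=
  Module.Basis.constr_basis _ _ _ _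

@[simp]
theorem basisCounit_apply (i : ι) : basisCounit b (b i) = 1 :=
  Module.Basis.constr_basis _ _ _ _

variable {b w}

theorem adjoint_basisMul [DecidableEq ι] [FiniteDimensional ℂ H]
    (hb : ∀ i j, ⟪b i, b j⟫_ℂ = if i = j then (w i : ℂ) else 0) :
    LinearMap.adjoint (basisMul b w) = basisComul b := by
  refine ((LinearMap.eq_adjoint_iff_basis b (b.tensorProduct b) _ _).mpr ?_).symm
  rintro i ⟨j, k⟩
  rw [basisComul_apply, Module.Basis.tensorProduct_apply, TensorProduct.inner_tmul,
    basisMul_tmul, hb, hb]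
  by_cases hjk : j = k
  · subst hjk
    by_cases hij : i = j
    · subst hij
      simp only [if_true, inner_smul_right, hb]
    · simp only [if_true, if_neg hij, inner_smul_right, hb, mul_zero]
  · rw [if_neg hjk, inner_zero_right]
    by_cases hij : i = j
    · rw [if_neg (fun h => hjk (hij.symm.trans h)), mul_zero]
    · rw [if_neg hij, zero_mul]

theorem adjoint_basisUnit [Fintype ι] [DecidableEq ι] [FiniteDimensional ℂ H]
    (hw : ∀ i, w i ≠ 0) (hb : ∀ i j, ⟪b i, b j⟫_ℂ = if i = j then (w i : ℂ) else 0) :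
    LinearMap.adjoint (basisUnit b w) = basisCounit b := by
  refine ((LinearMap.eq_adjoint_iff_basis_left b _ _).mpr fun i z => ?_).symm
  have h : (w i : ℂ) ≠ 0 := Complex.ofReal_ne_zero.mpr (hw i)
  simp only [basisCounit_apply, basisUnit, LinearMap.toSpanSingleton_apply, inner_smul_right,
    inner_sum, hb, mul_ite, mul_zero, Finset.sum_ite_eq, Finset.mem_univ, if_true]
  simp [h]

theorem isInternalMonoid_of_basis [Fintype ι] [DecidableEq ι] (hw : ∀ i, w i ≠ 0) :
    IsInternalMonoid (basisMul b w) (basisUnit b w) := by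
  have h (i : ι) : (w i : ℂ) ≠ 0 := Complex.ofReal_ne_zero.mpr (hw i)
  refine ⟨?_, ?_, ?_⟩
  · refine ((b.tensorProduct b).tensorProduct b).ext fun ⟨⟨i, j⟩, k⟩ => ?_
    simp only [Module.Basis.tensorProduct_apply, LinearMap.comp_apply, LinearMap.rTensor_tmul,
      LinearEquiv.coe_coe, TensorProduct.assoc_tmul, LinearMap.lTensor_tmul, basisMul_tmul]
    by_cases hij : i = j
    · subst hij
      by_cases hik : i = k
      · subst hik
        simp only [if_true, ← TensorProduct.smul_tmul', TensorProduct.tmul_smul]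
      · simp only [if_true, if_neg hik, ← TensorProduct.smul_tmul', map_smul, basisMul_tmul,
          smul_zero, TensorProduct.tmul_zero, map_zero]
    · by_cases hjk : j = k
      · simp only [if_neg hij, if_pos hjk, TensorProduct.zero_tmul, map_zero,
          TensorProduct.tmul_smul, map_smul, basisMul_tmul, smul_zero]
      · simp only [if_neg hij, if_neg hjk, TensorProduct.zero_tmul, TensorProduct.tmul_zero,
          map_zero]
  · ext : 2
    refine b.ext fun j => ?_
    simp only [TensorProduct.AlgebraTensorModule.curry_apply, TensorProduct.curry_apply,
      LinearMap.coe_restrictScalars, LinearMap.comp_apply, LinearMap.rTensor_tmul, basisUnit,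
      LinearMap.toSpanSingleton_apply, one_smul, TensorProduct.sum_tmul, map_sum,
      ← TensorProduct.smul_tmul', map_smul, basisMul_tmul, smul_ite, smul_zero,
      Finset.sum_ite_eq', Finset.mem_univ, if_true, smul_smul, inv_mul_cancel₀ (h _),
      LinearEquiv.coe_coe, TensorProduct.lid_tmul]
  · refine TensorProduct.ext (b.ext fun j => ?_)
    ext
    simp only [LinearMap.compr₂ₛₗ_apply, TensorProduct.mk_apply,
      LinearMap.comp_apply, LinearMap.lTensor_tmul, basisUnit,
      LinearMap.toSpanSingleton_apply, one_smul, TensorProduct.tmul_sum, map_sum,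
      TensorProduct.tmul_smul, map_smul, basisMul_tmul, smul_ite, smul_zero,
      Finset.sum_ite_eq, Finset.mem_univ, if_true, smul_smul, inv_mul_cancel₀ (h _),
      LinearEquiv.coe_coe, TensorProduct.rid_tmul]

theorem isInternalComonoid_of_basis : IsInternalComonoid (basisComul b) (basisCounit b) := by
  refine ⟨b.ext fun i => ?_, b.ext fun i => ?_, b.ext fun i => ?_⟩ <;> simp

theorem isCommDaggerFrobeniusMonoid_of_basis [Fintype ι] [DecidableEq ι] [FiniteDimensional ℂ H]
    (hw : ∀ i, w i ≠ 0) (hb : ∀ i j, ⟪b i, b j⟫_ℂ = if i = j then (w i : ℂ) else 0) :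
    IsCommDaggerFrobeniusMonoid (basisMul b w) (basisUnit b w) := by
  rw [IsCommDaggerFrobeniusMonoid, adjoint_basisMul hb, adjoint_basisUnit hw hb]
  refine ⟨⟨isInternalMonoid_of_basis hw, isInternalComonoid_of_basis, ?_, ?_⟩,
    b.ext fun i => by simp⟩
  all_goals
    refine (b.tensorProduct b).ext fun ⟨i, j⟩ => ?_
    by_cases hij : i = j
    · subst hij
      simp only [Module.Basis.tensorProduct_apply, LinearMap.comp_apply, LinearMap.rTensor_tmul,
        LinearEquiv.coe_coe, TensorProduct.assoc_tmul, TensorProduct.assoc_symm_tmul,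
        LinearMap.lTensor_tmul, basisMul_tmul, basisComul_apply, if_true, map_smul,
        ← TensorProduct.smul_tmul', TensorProduct.tmul_smul]
    · simp only [Module.Basis.tensorProduct_apply, LinearMap.comp_apply, LinearMap.rTensor_tmul,
        LinearEquiv.coe_coe, TensorProduct.assoc_tmul, TensorProduct.assoc_symm_tmul,
        LinearMap.lTensor_tmul, basisMul_tmul, basisComul_apply, if_neg hij, map_zero,
        TensorProduct.zero_tmul, TensorProduct.tmul_zero]

end OrthogonalBasis

namespace CommDaggerFrob

open scoped InnerProductSpace

/-- A basis of copyable points contains every copyable point: any other one would be orthogonal to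
the basis. -/
theorem IsCopyable.mem_range_of_basis {A : CommDaggerFrob.{u}} {ι : Type*}
    (b : Module.Basis ι ℂ A.carrier) (hb : ∀ i, IsCopyable (b i)) {x : A.carrier}
    (hx : IsCopyable x) : x ∈ Set.range b := by
  by_contra h
  have h0 : (innerₛₗ ℂ x : A.carrier →ₗ[ℂ] ℂ) = 0 := b.ext fun i => by
    simpa using hx.inner_eq_zero (hb i) fun e => h ⟨i, e.symm⟩
  exact hx.ne_zero (inner_self_eq_zero.mp (LinearMap.congr_fun h0 x))

theorem exists_points_iso (X : FinPosSet.{u}) :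
    ∃ A : CommDaggerFrob.{u}, Nonempty (points.obj A ≅ X) := by
  classical
  have := X.finite
  have := Fintype.ofFinite X.carrier
  let w (i : X.carrier) : ℝ := (X.weight i).1
  have hw (i : X.carrier) : 0 < w i := (X.weight i).2
  have hu (i : X.carrier) : IsUnit ((√(w i) : ℝ) : ℂ) :=
    isUnit_iff_ne_zero.mpr (Complex.ofReal_ne_zero.mpr (Real.sqrt_pos.mpr (hw i)).ne')
  -- The standard basis, rescaled so that the squared norms are the given weights.
  let b := (EuclideanSpace.basisFun X.carrier ℂ).toBasis.isUnitSMul hu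
  have hb (i j : X.carrier) : ⟪b i, b j⟫_ℂ = if i = j then (w i : ℂ) else 0 := by
    simp only [b, Module.Basis.isUnitSMul_apply, inner_smul_left, inner_smul_right,
      OrthonormalBasis.coe_toBasis, orthonormal_iff_ite.mp (OrthonormalBasis.orthonormal _),
      Complex.conj_ofReal]
    split_ifs with h
    · rw [← h, _root_.mul_one, ← Complex.ofReal_mul, Real.mul_self_sqrt (hw i).le]
    · simp
  let A : CommDaggerFrob.{u} :=
    { carrier := EuclideanSpace ℂ X.carrier
      mul := basisMul b w
      unit := basisUnit b w
      isCommDaggerFrobeniusMonoid :=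
        isCommDaggerFrobeniusMonoid_of_basis (fun i => (hw i).ne') hb }
  have hA (i : X.carrier) : IsCopyable (A := A) (b i) :=
    ⟨(LinearMap.congr_fun (adjoint_basisMul hb) (b i)).trans (basisComul_apply b i),
      (LinearMap.congr_fun (adjoint_basisUnit (fun i => (hw i).ne') hb) (b i)).trans
        (basisCounit_apply b i)⟩
  let e : X.carrier ≃ Point A := Equiv.ofBijective (fun i => ⟨b i, hA i⟩)
    ⟨fun i j h => b.injective (congrArg Subtype.val h), fun x => by
      obtain ⟨i, hi⟩ := IsCopyable.mem_range_of_basis (A := A) b hA x.2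
      exact ⟨i, Subtype.ext hi⟩⟩
  have he (i : X.carrier) : ‖b i‖ ^ 2 = w i := by
    rw [← inner_self_eq_norm_sq (𝕜 := ℂ), hb, if_pos rfl]
    exact Complex.ofReal_re _
  let f : X ⟶ points.obj A := { toEquiv := e, weight_map := fun i => Subtype.ext (he i) }
  exact ⟨A, ⟨(asIso f).symm⟩⟩

instance : points.{u}.EssSurj where
  mem_essImage := exists_points_iso

instance : points.{u}.IsEquivalence where

end CommDaggerFrob

theorem mainTheorem6 : Nonempty (CommDaggerFrob.{u} ≌ FinPosSet.{u}) := by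
  exact ⟨CommDaggerFrob.points.asEquivalence⟩
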